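/- Let $p$ be a prime and let $R$ be a finite nonzero (associative, unital, not necessarily commutative) ring such that $|R|$ is a power of $p$. For every integer $k \ge 1$, let $\mathcal{I}_{k+1}(R) = \{x \in R : x^{k+1} = x\}$ be the set of $(k+1)$-potent elements of $R$. Then $$|\mathcal{I}_{k+1}(R)| \le \frac{k+1}{p}\,|R|^{\frac{2k}{k+1}}.$$ -/

import Mathlib

/-- The set of `m`-potent elements of a ring `R`: those `x` with `x ^ m = x`. -/
def potentElements (R : Type*) [Ring R] (m : ℕ) : Set R := {x : R | x ^ m = x}

/-! Double count the sums `x + t` with `x` potent and `t < p`: each `y` arises at most `k + 1`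
times, since `X ^ (k + 1) - X` has at most `k + 1` roots in a field. So `|I| * p ≤ (k + 1) * |R|`,
and `2k / (k + 1) ≥ 1`. -/

open Polynomial in
/-- In a field of characteristic `p`, at most `k + 1` of the elements `y - t` with
`t ∈ {0, …, p - 1}` are `(k + 1)`-potent. -/
theorem card_potent_translates_le_of_field {K : Type*} [Field K] [DecidableEq K] (p : ℕ)
    [CharP K p] (k : ℕ) (hk : 1 ≤ k) (y : K) :
    ((Finset.range p).filter fun t : ℕ => (y - t) ^ (k + 1) = y - t).card ≤ k + 1 := by
  have hdeg : (X ^ (k + 1) - X : K[X]).natDegree = k + 1 :=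
    FiniteField.X_pow_card_sub_X_natDegree_eq K (by omega)
  have hne : (X ^ (k + 1) - X : K[X]) ≠ 0 := FiniteField.X_pow_card_sub_X_ne_zero K (by omega)
  calc _ ≤ (X ^ (k + 1) - X : K[X]).roots.toFinset.card := by
        refine Finset.card_le_card_of_injOn (fun t : ℕ => y - t) ?_ ?_
        · intro t ht
          have ht' := (Finset.mem_filter.1 ht).2
          simp [mem_roots hne, IsRoot.def, ht']
        · intro s hs t ht hst
          have hs' := Finset.mem_range.1 (Finset.mem_filter.1 hs).1
          have ht' := Finset.mem_range.1 (Finset.mem_filter.1 ht).1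
          exact CharP.natCast_injOn_Iio K p hs' ht' (sub_right_injective hst)
    _ ≤ _ := Multiset.toFinset_card_le _
    _ ≤ k + 1 := (card_roots' _).trans hdeg.le

/-- In a nonzero ring in which the prime `p` is nilpotent, at most `k + 1` of the elements
`y - t` with `t ∈ {0, …, p - 1}` are `(k + 1)`-potent. -/
theorem card_potent_translates_le {R : Type*} [Ring R] [Nontrivial R] [DecidableEq R]
    {p : ℕ} (hp : p.Prime) (hnil : IsNilpotent (p : R)) (k : ℕ) (hk : 1 ≤ k) (y : R) :
    ((Finset.range p).filter fun t : ℕ => (y - t) ^ (k + 1) = y - t).card ≤ k + 1 := by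
  classical
  -- `ℤ[y]` is commutative, so it has a residue field; as `p` is nilpotent, that field has
  -- characteristic `p` and keeps the `t < p` distinct.
  let A := Algebra.adjoin ℤ ({y} : Set R)
  have : IsMulCommutative A := Algebra.isMulCommutative_adjoin ℤ (by
    rintro a rfl b rfl; rfl)
  let _ : CommRing A := inferInstance
  obtain ⟨M, hM⟩ := Ideal.exists_maximal A
  let _ : Field (A ⧸ M) := Ideal.Quotient.field M
  let z : A := ⟨y, Algebra.self_mem_adjoin_singleton ℤ y⟩
  obtain ⟨n, hn⟩ := hnil
  have hnA : (p : A) ^ n = 0 := Subtype.ext (by push_cast; exact hn)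
  have hpK : (p : A ⧸ M) = 0 := by
    have := congrArg (Ideal.Quotient.mk M) hnA
    simp only [map_pow, map_natCast, map_zero] at this
    exact eq_zero_of_pow_eq_zero this
  have : CharP (A ⧸ M) p := (CharP.charP_iff_prime_eq_zero hp).2 hpK
  refine le_trans (Finset.card_le_card ?_)
    (card_potent_translates_le_of_field p k hk (Ideal.Quotient.mk M z))
  refine Finset.monotone_filter_right _ fun t _ ht => ?_
  have hA : (z - (t : A)) ^ (k + 1) = z - t := Subtype.ext (by push_cast; exact ht)
  simpa using congrArg (Ideal.Quotient.mk M) hA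

theorem mul_ncard_potentElements_le {R : Type*} [Ring R] [Finite R] [Nontrivial R]
    {p : ℕ} (hp : p.Prime) (hnil : IsNilpotent (p : R)) (k : ℕ) (hk : 1 ≤ k) :
    (potentElements R (k + 1)).ncard * p ≤ (k + 1) * Nat.card R := by
  classical
  have := Fintype.ofFinite R
  let I : Finset R := Finset.univ.filter fun x => x ^ (k + 1) = x
  have hI : potentElements R (k + 1) = (I : Set R) := by
    ext x; simp [I, potentElements]
  rw [hI, Set.ncard_coe_finset, Nat.card_eq_fintype_card]
  have := Finset.card_le_mul_card_image_of_maps_to (s := I ×ˢ Finset.range p)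
    (t := (Finset.univ : Finset R)) (f := fun q => q.1 + (q.2 : R))
    (fun _ _ => Finset.mem_univ _) (k + 1) (fun y _ => ?_)
  · simpa using this
  refine le_trans ?_ (card_potent_translates_le hp hnil k hk y)
  refine Finset.card_le_card_of_injOn Prod.snd ?_ ?_
  · rintro ⟨x, t⟩ h
    simp only [I, Finset.coe_filter, Finset.mem_product, Finset.mem_filter, Finset.mem_univ,
      true_and, Set.mem_ofPred_eq] at h ⊢
    obtain ⟨⟨hx, ht⟩, rfl⟩ := h
    exact ⟨ht, by simpa using hx⟩
  · rintro ⟨x, t⟩ h ⟨x', t'⟩ h' (rfl : t = t')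
    have e := (Finset.mem_filter.1 h).2.trans (Finset.mem_filter.1 h').2.symm
    exact Prod.ext (add_right_cancel e) rfl

theorem theorem2 {R : Type*} [Ring R] [Finite R] [Nontrivial R]
    (p : ℕ) (hp : p.Prime) (hR : ∃ r : ℕ, Nat.card R = p ^ r)
    (k : ℕ) (hk : 1 ≤ k) :
    ((potentElements R (k + 1)).ncard : ℝ) ≤
      (((k : ℝ) + 1) / (p : ℝ)) * (Nat.card R : ℝ) ^ ((2 * (k : ℝ)) / ((k : ℝ) + 1)) := by
  obtain ⟨r, hr⟩ := hR
  have hnil : IsNilpotent (p : R) := by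
    refine ⟨r, ?_⟩
    rw [← Nat.cast_pow, ← hr, ← nsmul_one, card_nsmul_eq_zero']
  have hp0 : (0 : ℝ) < p := by exact_mod_cast hp.pos
  have hk' : (1 : ℝ) ≤ k := by exact_mod_cast hk
  have hcount : ((potentElements R (k + 1)).ncard : ℝ) * p ≤ (k + 1) * Nat.card R := by
    exact_mod_cast mul_ncard_potentElements_le hp hnil k hk
  have hpow : (Nat.card R : ℝ) ≤ (Nat.card R : ℝ) ^ ((2 * (k : ℝ)) / ((k : ℝ) + 1)) := by
    refine Real.self_le_rpow_of_one_le ?_ ?_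
    · exact_mod_cast Nat.card_pos
    · rw [le_div_iff₀ (by positivity)]; linarith
  calc ((potentElements R (k + 1)).ncard : ℝ) ≤ (k + 1) / p * Nat.card R := by
        rw [div_mul_eq_mul_div, le_div_iff₀ hp0]; exact hcount
    _ ≤ _ := by gcongr
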